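/- Consider the $K$-armed bandit game over $T$ rounds against a fixed (oblivious) loss sequence $\ell_{1:T}=(\ell_{i,t})_{1\le i\le K,\,1\le t\le T}\in[0,1]^{KT}$. A randomised bandit algorithm may use an internal random seed drawn in advance; in each round $t$ it chooses a probability distribution on $\{1,\dots,K\}$ that depends measurably on the seed and on the history $(I_s,\ell_{I_s,s})_{s<t}$ of its own past actions and observed losses, and it draws its action $I_t$ from that distribution. Its regret is $$R_T(\ell_{1:T})=\sum_{t=1}^T \ell_{I_t,t}-\min_{1\le i\le K}\sum_{t=1}^T \ell_{i,t}.$$ Let $K\ge 2$, $\delta\in(0,1/4)$ and $T\ge 32(K-1)\log(2/\delta)$. Then for every randomised bandit algorithm there exists a loss sequence $\ell_{1:T}\in[0,1]^{KT}$ such that $$\mathbb{P}\left(R_T(\ell_{1:T})\ge \frac{1}{27}\sqrt{(K-1)T\log\frac{1}{4\delta}}\right)\ge \frac{\delta}{2},$$ where the probability is with respect to the randomness of the algorithm. Furthermore, $\ell_{1:T}$ can be chosen such that, in addition, there is an arm $i$ with $\ell_{i,t}=\min_j \ell_{j,t}$ for all $t\in\{1,\dots,T\}$, and for all $t\in\{1,\dots,T\}$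 $$\max_{j,k}\{\ell_{j,t}-\ell_{k,t}\}\le \frac{1}{4\sqrt{\log 2}}\sqrt{\frac{(K-1)\log(1/(4\delta))}{T}}.$$ -/

import Mathlib

open MeasureTheory ProbabilityTheory

noncomputable section

/-- The regret `∑ₜ ℓ_{Iₜ,t} - minᵢ ∑ₜ ℓ_{i,t}` of the action sequence `I` on the loss sequence `ℓ`
(`ℓ t i` is the loss of arm `i` in round `t`). -/
def regret {K T : ℕ} (ℓ : Fin T → Fin K → ℝ) (I : Fin T → Fin K) : ℝ :=
  ∑ t, ℓ t (I t) - ⨅ i, ∑ t, ℓ t i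

/-- The bandit history `(I_s, ℓ_{I_s,s})_{s<t}` available at the beginning of round `t`: the learner
has seen her own actions and the losses of the chosen arms only. -/
def banditHistory {K T : ℕ} (ℓ : Fin T → Fin K → ℝ) (I : Fin T → Fin K) (t : Fin T) :
    Fin t → Fin K × ℝ :=
  fun s => (I (s.castLE t.isLt.le), ℓ (s.castLE t.isLt.le) (I (s.castLE t.isLt.le)))

/-- A randomised `K`-armed bandit algorithm: a random seed drawn once from a probability measure
`seedLaw` on `Ω`, and for each round `t` a distribution `policy t (ω, h)` on the arms that depends
measurably on the seed `ω` and on the history `h` of the first `t` rounds.  A seedless algorithm has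
a one-point `Ω`; an algorithm that is a function of its seed and of the history has Dirac
policies. -/
structure BanditAlgorithm (K : ℕ) (Ω : Type*) [MeasurableSpace Ω] where
  seedLaw : Measure Ω
  isProbabilityMeasure_seedLaw : IsProbabilityMeasure seedLaw
  policy : (t : ℕ) → Kernel (Ω × (Fin t → Fin K × ℝ)) (Fin K)
  isMarkovKernel_policy : ∀ t, IsMarkovKernel (policy t)

/-- The law of the actions `(I_1, …, I_T)` when the algorithm faces the fixed losses `ℓ`: the seed is
drawn from `seedLaw`, then each action from the current policy given the seed and the bandit
history, so a sequence `I` has probability `∫ ∏ₜ policyₜ(ω, h_t)(I_t) d seedLaw(ω)`. -/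
def BanditAlgorithm.actionLaw {K : ℕ} {Ω : Type*} [MeasurableSpace Ω] (alg : BanditAlgorithm K Ω)
    {T : ℕ} (ℓ : Fin T → Fin K → ℝ) : Measure (Fin T → Fin K) :=
  ∑ I : Fin T → Fin K,
    (∫⁻ ω, ∏ t : Fin T, alg.policy t (ω, banditHistory ℓ I t) {I t} ∂alg.seedLaw) •
      Measure.dirac I

end

/-! All arms share one i.i.d. Gaussian noise sequence around `1 / 2`, clipped to `[0, 1]`. In the
base environment arm `a` is better by `d / 2`, and some arm `i ≠ a` has at most `T / (K - 1)`
expected plays. In the alternative arm `i` is better by `d`. Playing `a` at most half the time is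
costly in the first environment, playing it more than half the time in the second.

For a fixed action sequence the algorithm sees only the played losses, so lowering arm `i` amounts
to translating the noise in the rounds that play `i`. The resulting Gaussian tilt has relative
entropy `d ^ 2 / (2 * v)` times the expected plays of `i`, at most `log (1 / (4 * δ))` for the
chosen `d` and `v`. Bretagnolle-Huber (`exp_neg_le_sum_noisyWeight`) then gives one of the two
costly events probability at least `δ`.

Clipping hits more than `T / 4` rounds with probability at most `δ / 2`, by `measure_pi_card_gt_le`.
Otherwise at least `T / 4` unclipped suboptimal plays remain, each costing `d / 2`. Averaging over
the noise fixes one realisation (`exists_noise_of_sum_noisyWeight`); the shared noise keeps one arm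
best in every round. -/

open scoped NNReal ENNReal

/-! ### Gaussian tails and translations -/

/-- A Gaussian law is an exponential tilt of the centred Gaussian law with the same variance. -/
theorem gaussianReal_eq_withDensity_exp (a : ℝ) {v : ℝ≥0} (hv : v ≠ 0) :
    gaussianReal a v = (gaussianReal 0 v).withDensity
      (fun x => ENNReal.ofReal (Real.exp ((2 * a * x - a ^ 2) / (2 * v)))) := by
  rw [gaussianReal_of_var_ne_zero a hv, gaussianReal_of_var_ne_zero 0 hv,
    ← withDensity_mul _ (measurable_gaussianPDF 0 v) (by fun_prop)]
  congr 1
  ext x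
  simp only [Pi.mul_apply, gaussianPDF, gaussianPDFReal]
  rw [← ENNReal.ofReal_mul (by positivity), mul_assoc _ (Real.exp _) (Real.exp _), ← Real.exp_add]
  congr 3
  have : (v : ℝ) ≠ 0 := by exact_mod_cast hv
  field_simp
  ring

/-- Translating each tail onto a half-line through `0` costs the density factor `exp (-a ^ 2 / (2 *
v))`. The two half-lines are disjoint, so their masses total at most `1` and the union bound loses
no factor `2`. -/
theorem gaussianReal_abs_gt_le (a : ℝ) (ha : 0 ≤ a) {v : ℝ≥0} (hv : v ≠ 0) :
    (gaussianReal 0 v).real {x | a < |x|} ≤ Real.exp (-a ^ 2 / (2 * v)) := by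
  set γ := gaussianReal 0 v with hγ
  have key : ∀ (b : ℝ) (s : Set ℝ), MeasurableSet s → (∀ x ∈ s, b * x ≤ 0) → b ^ 2 = a ^ 2 →
      γ ((fun x => x + b) ⁻¹' s) ≤ ENNReal.ofReal (Real.exp (-a ^ 2 / (2 * v))) * γ s := by
    intro b s hs hbs hab
    rw [← Measure.map_apply (by fun_prop) hs, hγ, gaussianReal_map_add_const, zero_add,
      gaussianReal_eq_withDensity_exp b hv, withDensity_apply _ hs, ← hγ]
    calc ∫⁻ x in s, ENNReal.ofReal (Real.exp ((2 * b * x - b ^ 2) / (2 * v))) ∂γ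
        ≤ ∫⁻ x in s, ENNReal.ofReal (Real.exp (-a ^ 2 / (2 * v))) ∂γ := by
          refine setLIntegral_mono measurable_const fun x hx => ?_
          gcongr
          have := hbs x hx
          linarith
      _ = _ := by simp
  have h1 := key (-a) (Set.Ioi 0) measurableSet_Ioi
    (fun x hx => by have := mul_nonneg ha (le_of_lt (Set.mem_Ioi.1 hx)); linarith) (by ring)
  have h2 := key a (Set.Iio 0) measurableSet_Iio
    (fun x hx => mul_nonpos_of_nonneg_of_nonpos ha (le_of_lt hx)) rfl
  have hsub : {x : ℝ | a < |x|} ⊆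
      (fun x => x + -a) ⁻¹' Set.Ioi 0 ∪ (fun x => x + a) ⁻¹' Set.Iio 0 := by
    intro x hx
    rcases lt_abs.1 (Set.mem_ofPred_eq ▸ hx) with h | h
    · left; simp only [Set.mem_preimage, Set.mem_Ioi]; linarith
    · right; simp only [Set.mem_preimage, Set.mem_Iio]; linarith
  have hdisj : Disjoint (Set.Ioi (0 : ℝ)) (Set.Iio 0) :=
    Set.disjoint_left.2 fun x hx hx' => lt_asymm (Set.mem_Ioi.1 hx) (Set.mem_Iio.1 hx')
  have hle : γ {x : ℝ | a < |x|} ≤ ENNReal.ofReal (Real.exp (-a ^ 2 / (2 * v))) := by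
    calc γ {x : ℝ | a < |x|} ≤ _ := (measure_mono hsub).trans (measure_union_le _ _)
      _ ≤ _ := add_le_add h1 h2
      _ = ENNReal.ofReal (Real.exp (-a ^ 2 / (2 * v))) * γ (Set.Ioi 0 ∪ Set.Iio 0) := by
          rw [measure_union hdisj measurableSet_Iio, mul_add]
      _ ≤ _ := mul_le_of_le_one_right' prob_le_one
  exact ENNReal.toReal_le_of_le_ofReal (Real.exp_pos _).le hle

/-- A product of tilted measures is a tilt of the product measure. -/
theorem pi_withDensity_ofReal {ι : Type*} [Fintype ι] (μ : ι → Measure ℝ)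
    [∀ t, IsProbabilityMeasure (μ t)] (f : ι → ℝ → ℝ) (hf0 : ∀ t x, 0 ≤ f t x)
    (hfi : ∀ t, Integrable (f t) (μ t)) :
    Measure.pi (fun t => (μ t).withDensity fun x => ENNReal.ofReal (f t x)) =
      (Measure.pi μ).withDensity fun z => ENNReal.ofReal (∏ t, f t (z t)) := by
  have : ∀ t, IsFiniteMeasure ((μ t).withDensity fun x => ENNReal.ofReal (f t x)) := fun t =>
    isFiniteMeasure_withDensity_ofReal (hfi t).2
  refine Measure.pi_eq fun s hs => ?_
  rw [withDensity_apply _ (MeasurableSet.univ_pi hs), Measure.restrict_pi_pi,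
    ← ofReal_integral_eq_lintegral_ofReal
      (Integrable.fintype_prod_dep fun t => (hfi t).restrict)
      (Filter.Eventually.of_forall fun z => Finset.prod_nonneg fun t _ => hf0 t (z t)),
    integral_fintype_prod_eq_prod,
    ENNReal.ofReal_prod_of_nonneg fun t _ => integral_nonneg fun x => hf0 t x]
  refine Finset.prod_congr rfl fun t _ => ?_
  rw [withDensity_apply _ (hs t), ofReal_integral_eq_lintegral_ofReal (hfi t).restrict
    (Filter.Eventually.of_forall fun x => hf0 t x)]

/-- Translating i.i.d. Gaussian noise amounts to an exponential change of measure. -/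
theorem integral_pi_gaussianReal_add {ι : Type*} [Fintype ι] {v : ℝ≥0} (hv : v ≠ 0)
    (a : ι → ℝ) {F : (ι → ℝ) → ℝ} (hF : Measurable F) :
    ∫ z, F (fun t => z t + a t) ∂Measure.pi (fun _ : ι => gaussianReal 0 v) =
      ∫ z, Real.exp (∑ t, (2 * a t * z t - a t ^ 2) / (2 * v)) * F z
        ∂Measure.pi (fun _ : ι => gaussianReal 0 v) := by
  have hmap : (Measure.pi (fun _ : ι => gaussianReal 0 v)).map (fun z t => z t + a t) =
      Measure.pi (fun t => gaussianReal (a t) v) := by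
    rw [Measure.pi_map_pi (f := fun t x => x + a t) (fun t => by fun_prop)]
    simp [gaussianReal_map_add_const]
  have hint : ∀ t, Integrable (fun x => Real.exp ((2 * a t * x - a t ^ 2) / (2 * v)))
      (gaussianReal 0 v) := fun t => by
    have := (integrable_exp_mul_gaussianReal (μ := 0) (v := v) (a t / v)).mul_const
      (Real.exp (-(a t) ^ 2 / (2 * v)))
    refine this.congr (Filter.Eventually.of_forall fun x => ?_)
    simp only [← Real.exp_add]
    congr 1
    have : (v : ℝ) ≠ 0 := by exact_mod_cast hv
    field_simp
    ring
  have hdens := pi_withDensity_ofReal (fun _ : ι => gaussianReal 0 v)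
    (fun t x => Real.exp ((2 * a t * x - a t ^ 2) / (2 * v))) (fun t x => (Real.exp_pos _).le)
    hint
  simp_rw [← gaussianReal_eq_withDensity_exp _ hv, ← Real.exp_sum] at hdens
  have hcomp := integral_map (μ := Measure.pi (fun _ : ι => gaussianReal 0 v)) (f := F)
    (φ := fun z t => z t + a t) (by fun_prop : Measurable _).aemeasurable hF.aestronglyMeasurable
  rw [← hcomp, hmap, hdens,
    integral_withDensity_eq_integral_toReal_smul (by fun_prop) (by simp)]
  simp [ENNReal.toReal_ofReal, (Real.exp_pos _).le]

theorem integrable_exp_sum_pi_gaussianReal {ι : Type*} [Fintype ι] {v : ℝ≥0} (hv : v ≠ 0)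
    (a : ι → ℝ) :
    Integrable (fun z : ι → ℝ => Real.exp (∑ t, (2 * a t * z t - a t ^ 2) / (2 * v)))
      (Measure.pi (fun _ : ι => gaussianReal 0 v)) := by
  by_contra h
  -- For `F = 1` the left side is `1`, while without integrability the right side would be the
  -- default value `0`.
  have h1 := integral_pi_gaussianReal_add hv a (F := fun _ => 1) measurable_const
  simp [integral_undef h] at h1

/-! ### Bretagnolle-Huber and Chernoff inequalities -/

/-- A pointwise form of the Bretagnolle-Huber inequality. -/
theorem bretagnolle_huber_pointwise (κ g : ℝ) :
    Real.exp (-κ) * (1 - (g - κ) / 2) - Real.exp (-κ) / 4 * (1 + Real.exp (-g)) ≤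
      min 1 (Real.exp (-g)) := by
  set u := Real.exp (-g / 2)
  set s := Real.exp (-κ / 2)
  have hs : Real.exp (-κ) = s * s := by rw [← Real.exp_add]; congr 1; ring
  have hu : Real.exp (-g) = u * u := by rw [← Real.exp_add]; congr 1; ring
  have hs0 : 0 < s := Real.exp_pos _
  -- The tangent line of `exp` at `0` reduces the left side to `s * u - s ^ 2 / 4 * (1 + u ^ 2)`;
  -- completing squares gives both bounds.
  have hsu : s * (1 - (g - κ) / 2) ≤ u := by
    have h : u = s * Real.exp (-((g - κ) / 2)) := by
      simp only [u, s, ← Real.exp_add]; congr 1; ring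
    rw [h]
    gcongr
    have := Real.add_one_le_exp (-((g - κ) / 2))
    linarith
  have h2 := mul_le_mul_of_nonneg_left hsu hs0.le
  rw [hs, hu]
  refine le_min ?_ ?_
  · nlinarith [sq_nonneg (s * u / 2 - 1), sq_nonneg s]
  · nlinarith [sq_nonneg (s / 2 - u), sq_nonneg (s * u)]

/-- If each of `n` independent variables is bad with probability at most `1 / 8`, more than a
quarter of them are bad with probability at most `exp (-n / 32)`. -/
theorem measure_pi_card_gt_le (μ : Measure ℝ) [IsProbabilityMeasure μ] {B : Set ℝ}
    [DecidablePred (· ∈ B)] (hB : MeasurableSet B) (hμ : μ.real B ≤ 1 / 8) (n : ℕ) :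
    (Measure.pi (fun _ : Fin n => μ)).real
      {z | (n : ℝ) / 4 < (Finset.univ.filter fun t => z t ∈ B).card} ≤ Real.exp (-n / 32) := by
  set ν := Measure.pi (fun _ : Fin n => μ)
  -- Chernoff with base `2`: `f` is `2` on `B` and `1` off it, with mean at most `9 / 8`.
  set f : ℝ → ℝ := fun x => 1 + B.indicator 1 x
  have hfi : Integrable f μ := (integrable_const _).add ((integrable_const _).indicator hB)
  have hf1 : ∫ x, f x ∂μ ≤ 9 / 8 := by
    rw [integral_add (integrable_const _) ((integrable_const _).indicator hB),
      integral_indicator_one hB]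
    simp; linarith
  have hf0 : ∀ x, 0 < f x := fun x => by
    have : 0 ≤ B.indicator (1 : ℝ → ℝ) x := Set.indicator_nonneg (by simp) x
    simp only [f]; linarith
  have hprod : ∀ z : Fin n → ℝ,
      ∏ t, f (z t) = 2 ^ (Finset.univ.filter fun t => z t ∈ B).card := fun z => by
    rw [← Finset.prod_const, Finset.prod_filter]
    refine Finset.prod_congr rfl fun t _ => ?_
    by_cases h : z t ∈ B <;> simp [f, h]; norm_num
  have hi : Integrable (fun z : Fin n → ℝ => ∏ t, f (z t)) ν :=
    Integrable.fintype_prod (fun _ => hfi)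
  have hmarkov := mul_meas_ge_le_integral_of_nonneg
    (Filter.Eventually.of_forall fun z : Fin n → ℝ => Finset.prod_nonneg fun t _ => (hf0 (z t)).le)
    hi (2 ^ ((n : ℝ) / 4))
  rw [integral_fintype_prod_eq_pow, Fintype.card_fin] at hmarkov
  have hsub : {z : Fin n → ℝ | (n : ℝ) / 4 < (Finset.univ.filter fun t => z t ∈ B).card} ⊆
      {z | 2 ^ ((n : ℝ) / 4) ≤ ∏ t, f (z t)} := fun z hz => by
    simp only [Set.mem_ofPred_eq] at hz ⊢
    rw [hprod, ← Real.rpow_natCast]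
    exact Real.rpow_le_rpow_of_exponent_le one_le_two hz.le
  have h2 : (0 : ℝ) < 2 ^ ((n : ℝ) / 4) := by positivity
  -- After fourth powers, `(9 / 8) ^ 4 < 7 / 4 ≤ 2 * exp (-1 / 8)`.
  have hnum : (9 / 8 : ℝ) ≤ Real.exp (-1 / 32) * 2 ^ ((1 : ℝ) / 4) := by
    refine le_of_pow_le_pow_left₀ (n := 4) (by norm_num) (by positivity) ?_
    rw [mul_pow, ← Real.exp_nat_mul, ← Real.rpow_natCast (2 ^ ((1 : ℝ) / 4)), ← Real.rpow_mul
      (by norm_num)]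
    have := Real.add_one_le_exp (((4 : ℕ) : ℝ) * (-1 / 32))
    norm_num at this ⊢
    linarith
  have hpow : (9 / 8 : ℝ) ^ n ≤ Real.exp (-n / 32) * 2 ^ ((n : ℝ) / 4) := by
    calc (9 / 8 : ℝ) ^ n ≤ (Real.exp (-1 / 32) * 2 ^ ((1 : ℝ) / 4)) ^ n := by gcongr
      _ = _ := by
        rw [mul_pow, ← Real.exp_nat_mul, ← Real.rpow_mul_natCast (by norm_num)]
        congr 2 <;> ring
  have hI0 : 0 ≤ ∫ x, f x ∂μ := integral_nonneg fun x => (hf0 x).le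
  have hchain : 2 ^ ((n : ℝ) / 4) *
      ν.real {z | (n : ℝ) / 4 < (Finset.univ.filter fun t => z t ∈ B).card} ≤
      2 ^ ((n : ℝ) / 4) * Real.exp (-n / 32) := by
    calc _ ≤ _ := mul_le_mul_of_nonneg_left (measureReal_mono hsub) h2.le
      _ ≤ _ := hmarkov
      _ ≤ (9 / 8 : ℝ) ^ n := by gcongr
      _ ≤ _ := by rw [mul_comm]; exact hpow
  exact le_of_mul_le_mul_left hchain h2

/-! ### Probabilities of action sequences -/

namespace BanditAlgorithm

variable {K T : ℕ} {Ω : Type*} [MeasurableSpace Ω] (alg : BanditAlgorithm K Ω)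

/-- The probability of the action sequence `I` on the losses `ℓ`, given the seed `ω`. -/
noncomputable def seedWeight (ω : Ω) (ℓ : Fin T → Fin K → ℝ) (I : Fin T → Fin K) : ℝ≥0∞ :=
  ∏ t : Fin T, alg.policy t (ω, banditHistory ℓ I t) {I t}

/-- The probability of the action sequence `I` on the losses `ℓ`. -/
noncomputable def actionWeight (ℓ : Fin T → Fin K → ℝ) (I : Fin T → Fin K) : ℝ :=
  (∫⁻ ω, alg.seedWeight ω ℓ I ∂alg.seedLaw).toReal

theorem sum_policy_singleton (t : ℕ) (x : Ω × (Fin t → Fin K × ℝ)) :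
    ∑ a, alg.policy t x {a} = 1 := by
  have := alg.isMarkovKernel_policy t
  rw [sum_measure_singleton, Finset.coe_univ, measure_univ]

/-- Summing out the last action. -/
theorem sum_seedWeight_succ {n : ℕ} (ω : Ω) (ℓ : Fin (n + 1) → Fin K → ℝ)
    (H : (Fin n → Fin K) → ℝ≥0∞) :
    ∑ I : Fin (n + 1) → Fin K, H (fun s => I s.castSucc) * alg.seedWeight ω ℓ I =
      ∑ J : Fin n → Fin K, H J * alg.seedWeight ω (fun s => ℓ s.castSucc) J := by
  rw [← (Fin.snocEquiv fun _ => Fin K).sum_comp, Fintype.sum_prod_type, Finset.sum_comm]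
  refine Finset.sum_congr rfl fun J _ => ?_
  have hJ : ∀ (a : Fin K) (s : Fin n), Fin.snocEquiv (fun _ => Fin K) (a, J) s.castSucc = J s :=
    fun a s => by simp [Fin.snocEquiv]
  have hfac : ∀ a : Fin K, H (fun s => Fin.snocEquiv (fun _ => Fin K) (a, J) s.castSucc) *
      alg.seedWeight ω ℓ (Fin.snocEquiv (fun _ => Fin K) (a, J)) =
      H J * alg.seedWeight ω (fun s => ℓ s.castSucc) J *
        alg.policy n (ω, fun s => (J s, ℓ s.castSucc (J s))) {a} := by
    intro a
    set I := Fin.snocEquiv (fun _ => Fin K) (a, J) with hI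
    have hlast : I (Fin.last n) = a := by simp [hI, Fin.snocEquiv]
    have hcast : (fun s : Fin n => I s.castSucc) = J := funext (hJ a)
    clear_value I
    rw [hcast, mul_assoc]
    congr 1
    rw [seedWeight, seedWeight, Fin.prod_univ_castSucc, hlast]
    congr 1
    · subst hcast
      rfl
    · subst hcast
      rfl
  rw [Finset.sum_congr rfl fun a _ => hfac a, ← Finset.mul_sum, sum_policy_singleton, mul_one]

theorem sum_seedWeight (ω : Ω) (ℓ : Fin T → Fin K → ℝ) : ∑ I, alg.seedWeight ω ℓ I = 1 := by
  induction T with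
  | zero => simp [seedWeight]
  | succ n ih =>
    have h := alg.sum_seedWeight_succ ω ℓ (fun _ => 1)
    simp only [one_mul] at h
    rw [h, ih]

/-- The law of the action in round `t` only depends on the losses before round `t`. -/
theorem sum_seedWeight_congr (ω : Ω) {ℓ ℓ' : Fin T → Fin K → ℝ} (t : Fin T)
    (h : ∀ s < t, ℓ s = ℓ' s) (i : Fin K) :
    ∑ I : Fin T → Fin K, (if I t = i then 1 else 0) * alg.seedWeight ω ℓ I =
      ∑ I : Fin T → Fin K, (if I t = i then 1 else 0) * alg.seedWeight ω ℓ' I := by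
  induction T with
  | zero => exact t.elim0
  | succ n ih =>
    rcases Fin.eq_castSucc_or_eq_last t with ⟨t, rfl⟩ | rfl
    · rw [alg.sum_seedWeight_succ ω ℓ (fun J => if J t = i then 1 else 0),
        alg.sum_seedWeight_succ ω ℓ' (fun J => if J t = i then 1 else 0)]
      exact ih t fun s hs => h s.castSucc (by simpa using hs)
    · refine Finset.sum_congr rfl fun I _ => ?_
      congr 1
      refine Finset.prod_congr rfl fun s _ => ?_
      have : banditHistory ℓ I s = banditHistory ℓ' I s := by
        funext r
        have hr : r.castLE s.isLt.le < Fin.last n := by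
          simp only [Fin.lt_def, Fin.val_castLE, Fin.val_last]; omega
        simp only [banditHistory, h _ hr]
      rw [this]

theorem measurable_seedWeight {X : Type*} [MeasurableSpace X] {ℓ : X → Fin T → Fin K → ℝ}
    (hℓ : ∀ t i, Measurable fun x => ℓ x t i) (I : Fin T → Fin K) :
    Measurable fun p : X × Ω => alg.seedWeight p.2 (ℓ p.1) I := by
  refine Finset.measurable_prod _ fun t _ => ?_
  refine (Kernel.measurable_coe (alg.policy t) (measurableSet_singleton (I t))).comp
    (measurable_snd.prodMk (measurable_pi_lambda _ fun s => ?_))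
  exact measurable_const.prodMk ((hℓ _ _).comp measurable_fst)

theorem measurable_seedWeight_seed (ℓ : Fin T → Fin K → ℝ) (I : Fin T → Fin K) :
    Measurable fun ω => alg.seedWeight ω ℓ I :=
  (alg.measurable_seedWeight (X := Unit) (ℓ := fun _ => ℓ) (fun _ _ => measurable_const) I).comp
    (measurable_const.prodMk measurable_id : Measurable fun ω : Ω => ((), ω))

theorem measurable_actionWeight {X : Type*} [MeasurableSpace X] {ℓ : X → Fin T → Fin K → ℝ}
    (hℓ : ∀ t i, Measurable fun x => ℓ x t i) (I : Fin T → Fin K) :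
    Measurable fun x => alg.actionWeight (ℓ x) I := by
  have := alg.isProbabilityMeasure_seedLaw
  exact (alg.measurable_seedWeight hℓ I).lintegral_prod_right'.ennreal_toReal

theorem actionWeight_nonneg (ℓ : Fin T → Fin K → ℝ) (I : Fin T → Fin K) :
    0 ≤ alg.actionWeight ℓ I := ENNReal.toReal_nonneg

theorem sum_lintegral_seedWeight (ℓ : Fin T → Fin K → ℝ) :
    ∑ I, ∫⁻ ω, alg.seedWeight ω ℓ I ∂alg.seedLaw = 1 := by
  have := alg.isProbabilityMeasure_seedLaw
  rw [← lintegral_finsetSum _ fun I _ => alg.measurable_seedWeight_seed ℓ I]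
  simp [sum_seedWeight]

theorem lintegral_seedWeight_ne_top (ℓ : Fin T → Fin K → ℝ) (I : Fin T → Fin K) :
    ∫⁻ ω, alg.seedWeight ω ℓ I ∂alg.seedLaw ≠ ∞ := by
  refine ne_top_of_le_ne_top ENNReal.one_ne_top ?_
  rw [← alg.sum_lintegral_seedWeight ℓ]
  exact Finset.single_le_sum (f := fun I => ∫⁻ ω, alg.seedWeight ω ℓ I ∂alg.seedLaw)
    (fun _ _ => zero_le) (Finset.mem_univ I)

theorem sum_actionWeight (ℓ : Fin T → Fin K → ℝ) : ∑ I, alg.actionWeight ℓ I = 1 := by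
  simp only [actionWeight]
  rw [← ENNReal.toReal_sum fun I _ => alg.lintegral_seedWeight_ne_top ℓ I,
    sum_lintegral_seedWeight, ENNReal.toReal_one]

theorem actionWeight_le_one (ℓ : Fin T → Fin K → ℝ) (I : Fin T → Fin K) :
    alg.actionWeight ℓ I ≤ 1 := by
  rw [← alg.sum_actionWeight ℓ]
  exact Finset.single_le_sum (fun I _ => alg.actionWeight_nonneg ℓ I) (Finset.mem_univ I)

theorem sum_actionWeight_congr {ℓ ℓ' : Fin T → Fin K → ℝ} (t : Fin T)
    (h : ∀ s < t, ℓ s = ℓ' s) (i : Fin K) :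
    ∑ I : Fin T → Fin K, (if I t = i then 1 else 0) * alg.actionWeight ℓ I =
      ∑ I : Fin T → Fin K, (if I t = i then 1 else 0) * alg.actionWeight ℓ' I := by
  have key : ∀ ℓ : Fin T → Fin K → ℝ,
      ∑ I : Fin T → Fin K, (if I t = i then 1 else 0) * alg.actionWeight ℓ I =
      (∫⁻ ω, ∑ I : Fin T → Fin K, (if I t = i then 1 else 0) * alg.seedWeight ω ℓ I
        ∂alg.seedLaw).toReal := by
    intro ℓ
    rw [lintegral_finsetSum _ fun I _ => (alg.measurable_seedWeight_seed ℓ I).const_mul _,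
      ENNReal.toReal_sum]
    · refine Finset.sum_congr rfl fun I _ => ?_
      split_ifs <;> simp [actionWeight]
    · intro I _
      split_ifs
      · simpa using alg.lintegral_seedWeight_ne_top ℓ I
      · simp
  rw [key, key]
  congr 1
  exact lintegral_congr fun ω => alg.sum_seedWeight_congr ω t h i

theorem actionLaw_apply (ℓ : Fin T → Fin K → ℝ) (S : Set (Fin T → Fin K))
    [DecidablePred (· ∈ S)] :
    alg.actionLaw ℓ S = ENNReal.ofReal (∑ I with I ∈ S, alg.actionWeight ℓ I) := by
  rw [ENNReal.ofReal_sum_of_nonneg fun I _ => alg.actionWeight_nonneg ℓ I, actionLaw,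
    Measure.finsetSum_apply, Finset.sum_filter]
  refine Finset.sum_congr rfl fun I _ => ?_
  rw [Measure.smul_apply, Measure.dirac_apply' _ S.toFinite.measurableSet, actionWeight,
    ENNReal.ofReal_toReal (alg.lintegral_seedWeight_ne_top ℓ I)]
  by_cases h : I ∈ S <;> simp [h, seedWeight]

/-- The algorithm only sees the losses of the arms that it plays. -/
theorem actionWeight_congr {ℓ ℓ' : Fin T → Fin K → ℝ} {I : Fin T → Fin K}
    (h : ∀ t, ℓ t (I t) = ℓ' t (I t)) : alg.actionWeight ℓ I = alg.actionWeight ℓ' I := by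
  have : banditHistory ℓ I = banditHistory ℓ' I := by
    funext t s
    simp only [banditHistory, h]
  simp only [actionWeight, seedWeight, this]

end BanditAlgorithm

/-! ### Losses with shared clipped noise -/

/-- All arms share the noise `z` around the level `1 / 2`; arm `j` is better by `s j`, and losses are
clipped to `[0, 1]`. -/
noncomputable def noisyLoss {K T : ℕ} (s : Fin K → ℝ) (z : Fin T → ℝ) (t : Fin T) (j : Fin K) : ℝ :=
  max 0 (min 1 (1 / 2 + z t - s j))

section noisyLoss

variable {K T : ℕ} (s : Fin K → ℝ) (z : Fin T → ℝ)

theorem noisyLoss_mem_Icc (t : Fin T) (j : Fin K) : noisyLoss s z t j ∈ Set.Icc (0 : ℝ) 1 :=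
  ⟨le_max_left _ _, max_le zero_le_one (min_le_left _ _)⟩

theorem measurable_noisyLoss (t : Fin T) (j : Fin K) :
    Measurable fun z : Fin T → ℝ => noisyLoss s z t j := by
  unfold noisyLoss
  fun_prop

theorem noisyLoss_le_noisyLoss {i j : Fin K} (h : s j ≤ s i) (t : Fin T) :
    noisyLoss s z t i ≤ noisyLoss s z t j := by
  unfold noisyLoss
  gcongr

theorem noisyLoss_sub_le {d : ℝ} (hs : ∀ j, s j ∈ Set.Icc 0 d) (t : Fin T) (j k : Fin K) :
    noisyLoss s z t j - noisyLoss s z t k ≤ d := by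
  have hj := hs j
  have hk := hs k
  rw [Set.mem_Icc] at hj hk
  unfold noisyLoss
  rcases max_cases 0 (min 1 (1 / 2 + z t - s j)) with h1 | h1 <;>
  rcases max_cases 0 (min 1 (1 / 2 + z t - s k)) with h2 | h2 <;>
  rcases min_cases 1 (1 / 2 + z t - s j) with h3 | h3 <;>
  rcases min_cases 1 (1 / 2 + z t - s k) with h4 | h4 <;> linarith

theorem noisyLoss_of_abs_le {d : ℝ} (hs : ∀ j, s j ∈ Set.Icc 0 d) {t : Fin T}
    (hz : |z t| ≤ 1 / 2 - d) (j : Fin K) : noisyLoss s z t j = 1 / 2 + z t - s j := by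
  obtain ⟨h0, hd⟩ := hs j
  obtain ⟨h1, h2⟩ := abs_le.1 hz
  rw [noisyLoss, min_eq_right (by linarith), max_eq_right (by linarith)]

/-- The regret is at least the gap times the number of plays of suboptimal arms in rounds
without clipping. -/
theorem le_regret_noisyLoss {d Δ : ℝ} (hs : ∀ j, s j ∈ Set.Icc 0 d) (hΔ : 0 ≤ Δ) {b : Fin K}
    (hb : ∀ j, j ≠ b → s j ≤ s b - Δ) (I : Fin T → Fin K) :
    Δ * ((Finset.univ.filter fun t => I t ≠ b).card -
      (Finset.univ.filter fun t => z t ∈ {x : ℝ | 1 / 2 - d < |x|}).card) ≤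
      regret (noisyLoss s z) I := by
  have hinf : ⨅ i, ∑ t, noisyLoss s z t i ≤ ∑ t, noisyLoss s z t b :=
    ciInf_le (Set.finite_range _).bddBelow b
  have hsum : Δ * ((Finset.univ.filter fun t => I t ≠ b).card -
      (Finset.univ.filter fun t => z t ∈ {x : ℝ | 1 / 2 - d < |x|}).card) ≤
      ∑ t, (noisyLoss s z t (I t) - noisyLoss s z t b) := by
    rw [Finset.card_filter, Finset.card_filter]
    push_cast
    rw [← Finset.sum_sub_distrib, Finset.mul_sum]
    refine Finset.sum_le_sum fun t _ => ?_
    have hle : s (I t) ≤ s b := by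
      by_cases h : I t = b
      · rw [h]
      · linarith [hb _ h]
    have hmono := noisyLoss_le_noisyLoss s z hle t
    -- A clipped round contributes at most `0` on the left, while by monotonicity `b` is still a
    -- best arm there.
    by_cases hz : 1 / 2 - d < |z t|
    · have : (if I t ≠ b then (1 : ℝ) else 0) ≤ 1 := by split_ifs <;> norm_num
      simp only [Set.mem_ofPred_eq, hz, if_true]
      nlinarith
    · by_cases h : I t = b
      · simp only [Set.mem_ofPred_eq, hz, if_false, h, ne_eq, not_true_eq_false, sub_self, mul_zero,
          le_refl]
      · have := hb _ h
        rw [noisyLoss_of_abs_le s z hs (not_lt.1 hz), noisyLoss_of_abs_le s z hs (not_lt.1 hz)]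
        simp only [Set.mem_ofPred_eq, hz, if_false, ne_eq, h, not_false_eq_true, if_true]
        linarith
  rw [Finset.sum_sub_distrib] at hsum
  unfold regret
  linarith

end noisyLoss

/-! ### Gaussian noise and the change of environment -/

/-- The law of i.i.d. centred Gaussian noise of variance `v` over `T` rounds. -/
noncomputable abbrev gaussianNoise (v : ℝ≥0) (T : ℕ) : Measure (Fin T → ℝ) :=
  Measure.pi fun _ => gaussianReal 0 v

/-- A coordinate of the noise is uncorrelated with functions of the other coordinates. -/
theorem integral_eval_mul_eq_zero {v : ℝ≥0} {T : ℕ} (t : Fin T) {g : (Fin T → ℝ) → ℝ}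
    (hg : Measurable g) (h : ∀ z z' : Fin T → ℝ, (∀ s < t, z s = z' s) → g z = g z') :
    ∫ z, z t * g z ∂gaussianNoise v T = 0 := by
  -- Flipping the sign of `z t` preserves the noise law and `g`, so the integral equals its
  -- negative; this needs no integrability.
  set φ : (Fin T → ℝ) → (Fin T → ℝ) := fun z s => (if s = t then fun x => -x else id) (z s)
  have hφ : MeasurePreserving φ (gaussianNoise v T) (gaussianNoise v T) := by
    refine measurePreserving_pi _ _ fun s => ?_
    split_ifs
    · exact ⟨measurable_neg, by simpa using gaussianReal_map_neg (μ := 0) (v := v)⟩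
    · exact MeasurePreserving.id _
  have hflip : ∫ z, z t * g z ∂gaussianNoise v T = ∫ z, -(z t * g z) ∂gaussianNoise v T := by
    conv_lhs => rw [← hφ.map_eq]
    rw [integral_map hφ.measurable.aemeasurable
      (by fun_prop : Measurable fun z : Fin T → ℝ => z t * g z).aestronglyMeasurable]
    refine integral_congr_ae (Filter.Eventually.of_forall fun z => ?_)
    have : g (φ z) = g z := h _ _ fun s hs => by simp [φ, hs.ne]
    simp [this, φ]
  rw [integral_neg] at hflip
  linarith

theorem integrable_eval_gaussianNoise (v : ℝ≥0) {T : ℕ} (t : Fin T) :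
    Integrable (fun z : Fin T → ℝ => z t) (gaussianNoise v T) :=
  integrable_comp_eval (μ := fun _ : Fin T => gaussianReal 0 v) (i := t) (f := fun x : ℝ => x)
    ((memLp_id_gaussianReal 1).integrable (by simp))

namespace BanditAlgorithm

variable {K T : ℕ} {Ω : Type*} [MeasurableSpace Ω] (alg : BanditAlgorithm K Ω)

/-- Clipping comes after the shift, so on the played arms a shift of the losses and a translation of
the noise agree exactly. The change of measure can thus act on the unclipped noise. -/
theorem actionWeight_noisyLoss_add (s u : Fin K → ℝ) (z : Fin T → ℝ) (I : Fin T → Fin K) :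
    alg.actionWeight (noisyLoss (s + u) z) I =
      alg.actionWeight (noisyLoss s fun t => z t + -u (I t)) I := by
  refine alg.actionWeight_congr fun t => ?_
  simp only [noisyLoss, Pi.add_apply]
  congr 2
  ring

theorem measurable_actionWeight_noisyLoss (s : Fin K → ℝ) (I : Fin T → Fin K) :
    Measurable fun z => alg.actionWeight (noisyLoss s z) I :=
  alg.measurable_actionWeight (measurable_noisyLoss s) I

/-- The probability of the action sequence `I` under Gaussian noise and shifts `s`. -/
noncomputable def noisyWeight (v : ℝ≥0) (s : Fin K → ℝ) (I : Fin T → Fin K) : ℝ :=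
  ∫ z, alg.actionWeight (noisyLoss s z) I ∂gaussianNoise v T

theorem integrable_mul_actionWeight {v : ℝ≥0} (s : Fin K → ℝ) (I : Fin T → Fin K)
    {f : (Fin T → ℝ) → ℝ} (hf : Integrable f (gaussianNoise v T)) :
    Integrable (fun z => f z * alg.actionWeight (noisyLoss s z) I) (gaussianNoise v T) := by
  refine hf.mul_bdd (c := 1) (alg.measurable_actionWeight_noisyLoss s I).aestronglyMeasurable
    (Filter.Eventually.of_forall fun z => ?_)
  rw [Real.norm_of_nonneg (alg.actionWeight_nonneg _ _)]
  exact alg.actionWeight_le_one _ _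

theorem integrable_actionWeight (v : ℝ≥0) (s : Fin K → ℝ) (I : Fin T → Fin K) :
    Integrable (fun z => alg.actionWeight (noisyLoss s z) I) (gaussianNoise v T) := by
  simpa using alg.integrable_mul_actionWeight s I (integrable_const (1 : ℝ))

theorem noisyWeight_nonneg (v : ℝ≥0) (s : Fin K → ℝ) (I : Fin T → Fin K) :
    0 ≤ alg.noisyWeight v s I :=
  integral_nonneg fun _ => alg.actionWeight_nonneg _ _

theorem sum_noisyWeight (v : ℝ≥0) (s : Fin K → ℝ) :
    ∑ I : Fin T → Fin K, alg.noisyWeight v s I = 1 := by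
  simp only [noisyWeight]
  rw [← integral_finsetSum _ fun I _ => alg.integrable_actionWeight v s I]
  simp [sum_actionWeight]

/-- The noise of a round is uncorrelated with the action of that round. -/
theorem sum_integral_eval_mul_actionWeight (v : ℝ≥0) (s : Fin K → ℝ) (t : Fin T) (i : Fin K) :
    ∑ I : Fin T → Fin K, (if I t = i then 1 else 0) *
      ∫ z, z t * alg.actionWeight (noisyLoss s z) I ∂gaussianNoise v T = 0 := by
  have hint := fun I : Fin T → Fin K =>
    alg.integrable_mul_actionWeight s I (integrable_eval_gaussianNoise v t)
  simp_rw [← integral_const_mul]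
  rw [← integral_finsetSum _ fun I _ => (hint I).const_mul _]
  refine Eq.trans (integral_congr_ae (Filter.Eventually.of_forall fun z => ?_))
    (integral_eval_mul_eq_zero (v := v) t (g := fun z => ∑ I : Fin T → Fin K,
      (if I t = i then 1 else 0) * alg.actionWeight (noisyLoss s z) I) ?_ ?_)
  · simp only [Finset.mul_sum]
    exact Finset.sum_congr rfl fun I _ => by ring
  · exact Finset.measurable_sum _ fun I _ =>
      (alg.measurable_actionWeight_noisyLoss s I).const_mul _
  · intro z z' h
    refine alg.sum_actionWeight_congr t (fun r hr => ?_) i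
    funext j
    simp only [noisyLoss, h r hr]

/-- The expected number of plays of arm `i`. -/
noncomputable def expectedPlays (v : ℝ≥0) (s : Fin K → ℝ) (T : ℕ) (i : Fin K) : ℝ :=
  ∑ I : Fin T → Fin K, ∑ t, (if I t = i then 1 else 0) * alg.noisyWeight v s I

theorem expectedPlays_nonneg (v : ℝ≥0) (s : Fin K → ℝ) (i : Fin K) :
    0 ≤ alg.expectedPlays v s T i :=
  Finset.sum_nonneg fun I _ => Finset.sum_nonneg fun t _ =>
    mul_nonneg (by split_ifs <;> norm_num) (alg.noisyWeight_nonneg v s I)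

theorem sum_expectedPlays (v : ℝ≥0) (s : Fin K → ℝ) :
    ∑ i, alg.expectedPlays v s T i = T := by
  simp only [expectedPlays]
  rw [Finset.sum_comm]
  have : ∀ I : Fin T → Fin K,
      ∑ i, ∑ t, (if I t = i then 1 else 0) * alg.noisyWeight v s I = T * alg.noisyWeight v s I := by
    intro I
    rw [Finset.sum_comm]
    simp
  rw [Finset.sum_congr rfl fun I _ => this I, ← Finset.mul_sum, sum_noisyWeight, mul_one]

/-- Lowering the losses of a rarely played arm is hard to detect. -/
theorem exp_neg_le_sum_noisyWeight {v : ℝ≥0} (hv : v ≠ 0) (s : Fin K → ℝ) (i : Fin K) {d κ : ℝ}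
    (hκ : d ^ 2 / (2 * v) * alg.expectedPlays v s T i ≤ κ) (A : Finset (Fin T → Fin K)) :
    Real.exp (-κ) / 2 ≤ ∑ I ∈ A, alg.noisyWeight v s I +
      ∑ I ∈ Aᶜ, alg.noisyWeight v (s + Pi.single i d) I := by
  have hv0 : (v : ℝ) ≠ 0 := by exact_mod_cast hv
  set u : Fin K → ℝ := Pi.single i d
  have hu : ∀ j, u j = (if j = i then 1 else 0) * d := fun j => by
    simp [u, Pi.single_apply]
  set w : (Fin T → Fin K) → (Fin T → ℝ) → ℝ := fun I z => alg.actionWeight (noisyLoss s z) I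
  have hw0 : ∀ I z, 0 ≤ w I z := fun I z => alg.actionWeight_nonneg _ _
  have hwi : ∀ I, Integrable (w I) (gaussianNoise v T) := alg.integrable_actionWeight v s
  -- The log-likelihood ratio of base to alternative; its base mean is the relative entropy.
  set G : (Fin T → Fin K) → (Fin T → ℝ) → ℝ := fun I z =>
    ∑ t, (2 * u (I t) * z t + u (I t) ^ 2) / (2 * v)
  have hGexp : ∀ I z, Real.exp (∑ t, (2 * (-u (I t)) * z t - (-u (I t)) ^ 2) / (2 * v)) =
      Real.exp (-G I z) := fun I z => by
    simp only [G]
    rw [← Finset.sum_neg_distrib]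
    congr 1
    exact Finset.sum_congr rfl fun t _ => by ring
  have hEi : ∀ I, Integrable (fun z => Real.exp (-G I z) * w I z) (gaussianNoise v T) := fun I => by
    refine alg.integrable_mul_actionWeight s I ?_
    simpa only [hGexp] using
      integrable_exp_sum_pi_gaussianReal hv (fun t : Fin T => -u (I t))
  have hE : ∀ I, alg.noisyWeight v (s + u) I =
      ∫ z, Real.exp (-G I z) * w I z ∂gaussianNoise v T := fun I => by
    simp only [noisyWeight, actionWeight_noisyLoss_add, ← hGexp]
    exact integral_pi_gaussianReal_add hv (fun t => -u (I t))
      (alg.measurable_actionWeight_noisyLoss s I)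
  have hterm : ∀ (I : Fin T → Fin K) (t : Fin T), Integrable (fun z : Fin T → ℝ =>
      (2 * u (I t) * z t + u (I t) ^ 2) / (2 * v)) (gaussianNoise v T) := fun I t =>
    (((integrable_eval_gaussianNoise v t).const_mul _).add (integrable_const _)).div_const _
  have hGi : ∀ I, Integrable (fun z => G I z * w I z) (gaussianNoise v T) := fun I =>
    alg.integrable_mul_actionWeight s I (integrable_finsetSum _ fun t _ => hterm I t)
  have hGint : ∀ I, ∫ z, G I z * w I z ∂gaussianNoise v T =
      ∑ t, (d / v * ((if I t = i then 1 else 0) * ∫ z, z t * w I z ∂gaussianNoise v T) +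
        d ^ 2 / (2 * v) * ((if I t = i then 1 else 0) * alg.noisyWeight v s I)) := fun I => by
    simp only [G, Finset.sum_mul]
    rw [integral_finsetSum _ fun t _ => alg.integrable_mul_actionWeight s I (hterm I t)]
    refine Finset.sum_congr rfl fun t _ => ?_
    have hz := alg.integrable_mul_actionWeight s I (integrable_eval_gaussianNoise v t)
    rw [noisyWeight, ← integral_const_mul, ← integral_const_mul, ← integral_const_mul,
      ← integral_const_mul, ← integral_add ((hz.const_mul _).const_mul _)
        (((hwi I).const_mul _).const_mul _)]
    refine integral_congr_ae (Filter.Eventually.of_forall fun z => ?_)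
    simp only [hu, w]
    split_ifs
    · field_simp
    · simp
  have hGsum : ∑ I, ∫ z, G I z * w I z ∂gaussianNoise v T ≤ κ := by
    refine le_trans (le_of_eq ?_) hκ
    simp only [hGint, Finset.sum_add_distrib, expectedPlays, Finset.mul_sum]
    -- The part of `G` linear in the noise has mean zero, leaving only the count of plays of `i`.
    rw [add_eq_right, Finset.sum_comm]
    refine Finset.sum_eq_zero fun t _ => ?_
    rw [← Finset.mul_sum, alg.sum_integral_eval_mul_actionWeight v s t i, mul_zero]
  -- The integrated left side of the pointwise inequality: a lower bound for both weights of `I`, so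
  -- it can be summed over `A` and `Aᶜ` separately.
  set low : (Fin T → Fin K) → ℝ := fun I =>
    Real.exp (-κ) * ((1 + κ / 2) * alg.noisyWeight v s I -
        (∫ z, G I z * w I z ∂gaussianNoise v T) / 2) -
      Real.exp (-κ) / 4 * (alg.noisyWeight v s I + alg.noisyWeight v (s + u) I)
  have hlow : ∀ I, low I = ∫ z, (Real.exp (-κ) * (1 - (G I z - κ) / 2) -
      Real.exp (-κ) / 4 * (1 + Real.exp (-G I z))) * w I z ∂gaussianNoise v T := fun I => by
    have h1 := (hwi I).const_mul (Real.exp (-κ) * (1 + κ / 2) - Real.exp (-κ) / 4)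
    have h2 := (hGi I).const_mul (Real.exp (-κ) / 2)
    have h3 := (hEi I).const_mul (Real.exp (-κ) / 4)
    have : low I = (Real.exp (-κ) * (1 + κ / 2) - Real.exp (-κ) / 4) *
        ∫ z, w I z ∂gaussianNoise v T - Real.exp (-κ) / 2 *
        (∫ z, G I z * w I z ∂gaussianNoise v T) - Real.exp (-κ) / 4 *
        ∫ z, Real.exp (-G I z) * w I z ∂gaussianNoise v T := by
      simp only [low, hE]
      simp only [noisyWeight, w]
      ring
    rw [this, ← integral_const_mul, ← integral_const_mul, ← integral_const_mul,
      ← integral_sub h1 h2, ← integral_sub (h1.sub' h2) h3]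
    refine integral_congr_ae (Filter.Eventually.of_forall fun z => ?_)
    simp only
    ring
  have hlowi : ∀ I, Integrable (fun z => (Real.exp (-κ) * (1 - (G I z - κ) / 2) -
      Real.exp (-κ) / 4 * (1 + Real.exp (-G I z))) * w I z) (gaussianNoise v T) := fun I => by
    have h1 := (hwi I).const_mul (Real.exp (-κ) * (1 + κ / 2) - Real.exp (-κ) / 4)
    have h2 := (hGi I).const_mul (Real.exp (-κ) / 2)
    have h3 := (hEi I).const_mul (Real.exp (-κ) / 4)
    refine ((h1.sub h2).sub h3).congr (Filter.Eventually.of_forall fun z => ?_)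
    simp only [Pi.sub_apply]
    ring
  have hA : ∀ I, low I ≤ alg.noisyWeight v s I := fun I => by
    rw [hlow]
    refine integral_mono (hlowi I) (hwi I) fun z => ?_
    exact mul_le_of_le_one_left (hw0 I z)
      ((bretagnolle_huber_pointwise κ (G I z)).trans (min_le_left _ _))
  have hAc : ∀ I, low I ≤ alg.noisyWeight v (s + u) I := fun I => by
    rw [hlow, hE]
    refine integral_mono (hlowi I) (hEi I) fun z => ?_
    exact mul_le_mul_of_nonneg_right
      ((bretagnolle_huber_pointwise κ (G I z)).trans (min_le_right _ _)) (hw0 I z)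
  have htotal : Real.exp (-κ) / 2 ≤ ∑ I, low I := by
    simp only [low, Finset.sum_sub_distrib, ← Finset.mul_sum, Finset.sum_add_distrib,
      ← Finset.sum_div, sum_noisyWeight]
    nlinarith [Real.exp_pos (-κ)]
  calc Real.exp (-κ) / 2 ≤ ∑ I, low I := htotal
    _ = ∑ I ∈ A, low I + ∑ I ∈ Aᶜ, low I := (Finset.sum_add_sum_compl A low).symm
    _ ≤ _ := add_le_add (Finset.sum_le_sum fun I _ => hA I) (Finset.sum_le_sum fun I _ => hAc I)

/-! ### From random noise to a fixed loss sequence -/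

/-- If suboptimal arms are often played with probability `δ` under random noise, some noise
realisation makes the regret large with probability `δ / 2`. -/
theorem exists_noise_of_sum_noisyWeight {v : ℝ≥0} {s : Fin K → ℝ} {d δ : ℝ} (hδ : 0 < δ)
    (hd : 0 ≤ d) (hs : ∀ j, s j ∈ Set.Icc 0 d) {b : Fin K} (hb : ∀ j, j ≠ b → s j ≤ s b - d / 2)
    (A : Finset (Fin T → Fin K))
    (hA : ∀ I ∈ A, (T : ℝ) / 2 ≤ (Finset.univ.filter fun t => I t ≠ b).card)
    (hAw : δ ≤ ∑ I ∈ A, alg.noisyWeight v s I)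
    (htail : (gaussianReal 0 v).real {x | 1 / 2 - d < |x|} ≤ 1 / 8)
    (hT : Real.exp (-T / 32) ≤ δ / 2) :
    ∃ z : Fin T → ℝ, ENNReal.ofReal (δ / 2) ≤
      alg.actionLaw (noisyLoss s z) {I | d * T / 8 ≤ regret (noisyLoss s z) I} := by
  classical
  set B : Set ℝ := {x | 1 / 2 - d < |x|}
  have hB : MeasurableSet B := measurableSet_lt measurable_const measurable_id.abs
  set bad : Set (Fin T → ℝ) :=
    {z | (T : ℝ) / 4 < (Finset.univ.filter fun t => z t ∈ B).card}
  have hbad : MeasurableSet bad := by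
    refine measurableSet_lt measurable_const ?_
    simp only [Finset.card_filter, Nat.cast_sum]
    refine Finset.measurable_sum _ fun t _ => ?_
    simp only [Nat.cast_ite, Nat.cast_one, Nat.cast_zero]
    exact Measurable.ite (measurable_pi_apply t hB) measurable_const measurable_const
  have hbadν : (gaussianNoise v T).real bad ≤ δ / 2 :=
    (measure_pi_card_gt_le (gaussianReal 0 v) hB htail T).trans hT
  -- Subtracting the indicator of `bad` makes `F ≤ 0` there, so a point where `F` reaches its mean
  -- has both few clipped rounds and a likely event `A`.
  set F : (Fin T → ℝ) → ℝ := fun z =>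
    ∑ I ∈ A, alg.actionWeight (noisyLoss s z) I - bad.indicator 1 z
  have hi1 : Integrable (fun z => ∑ I ∈ A, alg.actionWeight (noisyLoss s z) I)
      (gaussianNoise v T) := integrable_finsetSum _ fun I _ => alg.integrable_actionWeight v s I
  have hi2 : Integrable (bad.indicator (1 : (Fin T → ℝ) → ℝ)) (gaussianNoise v T) :=
    (integrable_const _).indicator hbad
  have hF : δ / 2 ≤ ∫ z, F z ∂gaussianNoise v T := by
    rw [integral_sub hi1 hi2, integral_indicator_one hbad,
      integral_finsetSum _ fun I _ => alg.integrable_actionWeight v s I]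
    simp only [noisyWeight] at hAw
    linarith
  obtain ⟨z, hz⟩ := exists_integral_le (hi1.sub hi2 : Integrable F (gaussianNoise v T))
  have hFz : δ / 2 ≤ F z := hF.trans hz
  have hgood : z ∉ bad := fun h => by
    have h1 : ∑ I ∈ A, alg.actionWeight (noisyLoss s z) I ≤ 1 := by
      rw [← alg.sum_actionWeight (noisyLoss s z)]
      exact Finset.sum_le_sum_of_subset_of_nonneg (Finset.subset_univ A)
        fun I _ _ => alg.actionWeight_nonneg _ I
    simp only [F, Set.indicator_of_mem h, Pi.one_apply] at hFz
    linarith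
  refine ⟨z, ?_⟩
  rw [actionLaw_apply]
  refine ENNReal.ofReal_le_ofReal ?_
  simp only [F, Set.indicator_of_notMem hgood, sub_zero] at hFz
  refine hFz.trans (Finset.sum_le_sum_of_subset_of_nonneg (fun I hI => ?_)
    fun I _ _ => alg.actionWeight_nonneg _ I)
  have hreg := le_regret_noisyLoss s z hs (by positivity : 0 ≤ d / 2) hb I
  have hcard : ((Finset.univ.filter fun t => z t ∈ B).card : ℝ) ≤ T / 4 := not_lt.1 hgood
  simp only [Finset.mem_filter, Finset.mem_univ, true_and, Set.mem_ofPred_eq]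
  refine le_trans ?_ hreg
  have := hA I hI
  have h4 : (T : ℝ) / 4 ≤ (Finset.univ.filter fun t => I t ≠ b).card -
      (Finset.univ.filter fun t => z t ∈ B).card := by linarith
  calc d * T / 8 = d / 2 * (T / 4) := by ring
    _ ≤ d / 2 * ((Finset.univ.filter fun t => I t ≠ b).card -
      (Finset.univ.filter fun t => z t ∈ B).card) := by gcongr
    _ = _ := by congr!

theorem exists_expectedPlays_le (hK : 2 ≤ K) (v : ℝ≥0) (s : Fin K → ℝ) (a : Fin K) :
    ∃ i ≠ a, ((K : ℝ) - 1) * alg.expectedPlays v s T i ≤ T := by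
  have hcard : ((Finset.univ.erase a).card : ℝ) = K - 1 := by
    rw [Finset.card_erase_of_mem (Finset.mem_univ a), Finset.card_univ, Fintype.card_fin]
    push_cast [show 1 ≤ K by omega]
    rfl
  have hK' : (2 : ℝ) ≤ K := by exact_mod_cast hK
  have hsum : ∑ i ∈ Finset.univ.erase a, alg.expectedPlays v s T i ≤ T := by
    rw [← alg.sum_expectedPlays v s]
    exact Finset.sum_le_sum_of_subset_of_nonneg (Finset.subset_univ _)
      fun i _ _ => alg.expectedPlays_nonneg v s i
  obtain ⟨i, hi, hle⟩ := Finset.exists_le_of_sum_le (s := Finset.univ.erase a)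
    (f := fun i => ((K : ℝ) - 1) * alg.expectedPlays v s T i) (g := fun _ => (T : ℝ))
    (Finset.card_pos.1 (by have : (0 : ℝ) < (Finset.univ.erase a).card := by linarith
                           exact_mod_cast this))
    (by rw [← Finset.mul_sum, Finset.sum_const, nsmul_eq_mul, hcard]
        exact mul_le_mul_of_nonneg_left hsum (by linarith))
  exact ⟨i, Finset.ne_of_mem_erase hi, hle⟩

end BanditAlgorithm

/-- For suitable shifts of a Gaussian noise sequence, some realisation makes the regret large. -/
theorem BanditAlgorithm.exists_hard_noise {K T : ℕ} {Ω : Type*} [MeasurableSpace Ω]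
    (alg : BanditAlgorithm K Ω) (hK : 2 ≤ K) {v : ℝ≥0} (hv : v ≠ 0) {d δ κ : ℝ} (hδ₀ : 0 < δ)
    (hd0 : 0 ≤ d) (hdiv : d ^ 2 / (2 * v) * T ≤ ((K : ℝ) - 1) * κ)
    (hκδ : 2 * δ ≤ Real.exp (-κ) / 2)
    (htail : (gaussianReal 0 v).real {x | 1 / 2 - d < |x|} ≤ 1 / 8)
    (hexpT : Real.exp (-T / 32) ≤ δ / 2) :
    ∃ (s : Fin K → ℝ) (b : Fin K) (z : Fin T → ℝ), (∀ j, s j ∈ Set.Icc 0 d) ∧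
      (∀ j, j ≠ b → s j ≤ s b - d / 2) ∧ ENNReal.ofReal (δ / 2) ≤
        alg.actionLaw (noisyLoss s z) {I | d * T / 8 ≤ regret (noisyLoss s z) I} := by
  have hK1 : (0 : ℝ) < K - 1 := by
    have : (2 : ℝ) ≤ K := by exact_mod_cast hK
    linarith
  let a : Fin K := ⟨0, by omega⟩
  set s : Fin K → ℝ := Pi.single a (d / 2)
  obtain ⟨i, hia, hplays⟩ := alg.exists_expectedPlays_le (T := T) hK v s a
  have hκ : d ^ 2 / (2 * v) * alg.expectedPlays v s T i ≤ κ := by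
    have h := mul_le_mul_of_nonneg_left hplays (by positivity : 0 ≤ d ^ 2 / (2 * (v : ℝ)))
    refine le_of_mul_le_mul_left ?_ hK1
    linarith
  set A : Finset (Fin T → Fin K) := Finset.univ.filter fun I =>
    (T : ℝ) / 2 ≤ (Finset.univ.filter fun t => I t ≠ a).card
  have hinfo := hκδ.trans (alg.exp_neg_le_sum_noisyWeight hv s i hκ A)
  -- Arm `a` keeps its advantage `d / 2`, so raising `i` to `d` leaves the same gap `d / 2` as in
  -- the base environment.
  obtain ⟨s', hs'⟩ : ∃ s' : Fin K → ℝ, s' = s + Pi.single i d := ⟨_, rfl⟩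
  rw [← hs'] at hinfo
  rcases le_total δ (∑ I ∈ A, alg.noisyWeight v s I) with hcase | hcase
  · have hs : ∀ j, s j ∈ Set.Icc 0 d := fun j => by
      simp only [s, Pi.single_apply]
      split_ifs <;> constructor <;> linarith
    have hb : ∀ j, j ≠ a → s j ≤ s a - d / 2 := fun j hj => by simp [s, hj]
    obtain ⟨z, hz⟩ := alg.exists_noise_of_sum_noisyWeight hδ₀ hd0 hs hb A
      (fun I hI => (Finset.mem_filter.1 hI).2) hcase htail hexpT
    exact ⟨s, a, z, hs, hb, hz⟩
  · have hs : ∀ j, s' j ∈ Set.Icc 0 d := fun j => by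
      simp only [hs', s, Pi.add_apply, Pi.single_apply]
      split_ifs with h1 h2
      · exact absurd (h2.symm.trans h1) hia
      all_goals constructor <;> linarith
    have hb : ∀ j, j ≠ i → s' j ≤ s' i - d / 2 := fun j hj => by
      simp only [hs', s, Pi.add_apply, Pi.single_apply, hj, hia, if_false, if_true]
      split_ifs <;> linarith
    have hA : ∀ I ∈ Aᶜ, (T : ℝ) / 2 ≤ (Finset.univ.filter fun t => I t ≠ i).card := fun I hI => by
      have hlt : ((Finset.univ.filter fun t => I t ≠ a).card : ℝ) < T / 2 := by
        simpa [A] using hI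
      have hsplit : ((Finset.univ.filter fun t => I t = a).card : ℝ) +
          (Finset.univ.filter fun t => I t ≠ a).card = T := by
        have := Finset.card_filter_add_card_filter_not (s := Finset.univ) (fun t => I t = a)
        rw [Finset.card_univ, Fintype.card_fin] at this
        exact_mod_cast this
      have hsub : ((Finset.univ.filter fun t => I t = a).card : ℝ) ≤
          (Finset.univ.filter fun t => I t ≠ i).card := by
        gcongr with t
        rintro h h'
        exact hia (h'.symm.trans h)
      linarith
    obtain ⟨z, hz⟩ := alg.exists_noise_of_sum_noisyWeight hδ₀ hd0 hs hb Aᶜ hA (by linarith)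
      htail hexpT
    exact ⟨s', i, z, hs, hb, hz⟩

theorem theorem1 (K T : ℕ) (hK : 2 ≤ K) (δ : ℝ) (hδ₀ : 0 < δ) (hδ₁ : δ < 1 / 4)
    (hT : 32 * ((K : ℝ) - 1) * Real.log (2 / δ) ≤ (T : ℝ))
    {Ω : Type*} [MeasurableSpace Ω] (alg : BanditAlgorithm K Ω) :
    ∃ ℓ : Fin T → Fin K → ℝ,
      (∀ t i, ℓ t i ∈ Set.Icc (0 : ℝ) 1) ∧
      ENNReal.ofReal (δ / 2) ≤
        alg.actionLaw ℓ {I | 1 / 27 * √(((K : ℝ) - 1) * T * Real.log (1 / (4 * δ))) ≤ regret ℓ I} ∧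
      (∃ i, ∀ t j, ℓ t i ≤ ℓ t j) ∧
      (∀ t j k, ℓ t j - ℓ t k ≤
        √(((K : ℝ) - 1) * Real.log (1 / (4 * δ)) / T) / (4 * √(Real.log 2))) := by
  have hK1 : (1 : ℝ) ≤ K - 1 := by
    have : (2 : ℝ) ≤ K := by exact_mod_cast hK
    linarith
  set L := Real.log (1 / (4 * δ)) with hL
  have hL0 : 0 < L := Real.log_pos (by rw [lt_div_iff₀ (by positivity)]; linarith)
  have hLle : L ≤ Real.log (2 / δ) := by
    refine Real.log_le_log (by positivity) ?_
    rw [div_le_div_iff₀ (by positivity) hδ₀]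
    linarith
  have hlogT : Real.log (2 / δ) ≤ T / 32 := by nlinarith
  have hT0 : (0 : ℝ) < T := by linarith
  have hlog2 := Real.log_two_gt_d9
  have hlog2' := Real.log_two_lt_d9
  have hlog20 : 0 < Real.log 2 := by linarith
  -- With this variance, `exp (-x ^ 2 / (2 * v)) = 2 ^ (-16 * x ^ 2)`, which is `1 / 16` at `x = 1 /
  -- 2`; this leaves room for `1 / 8` at `1 / 2 - d`.
  set v : ℝ≥0 := Real.toNNReal (1 / (32 * Real.log 2))
  have hvr : (v : ℝ) = 1 / (32 * Real.log 2) := Real.coe_toNNReal _ (by positivity)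
  have hv : v ≠ 0 := by
    rw [← NNReal.coe_ne_zero, hvr]
    positivity
  set d := √(((K : ℝ) - 1) * L / T) / (4 * √(Real.log 2)) with hd
  have hX0 : 0 ≤ ((K : ℝ) - 1) * L := by positivity
  have hd0 : 0 ≤ d := by positivity
  have hd2 : 16 * Real.log 2 * d ^ 2 = ((K : ℝ) - 1) * L / T := by
    rw [hd, div_pow, mul_pow, Real.sq_sqrt (by positivity), Real.sq_sqrt hlog20.le]
    field_simp
    norm_num
  -- Enough for the tail bound, since `16 * (1 / 2 - 3 / 50) ^ 2 > 3`.
  have hdle : d ≤ 3 / 50 := by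
    have h1 : ((K : ℝ) - 1) * L / T ≤ 1 / 32 := by
      rw [div_le_iff₀ hT0]
      nlinarith
    refine le_of_sq_le_sq ?_ (by norm_num)
    nlinarith [sq_nonneg d]
  have htail : (gaussianReal 0 v).real {x | 1 / 2 - d < |x|} ≤ 1 / 8 := by
    refine (gaussianReal_abs_gt_le (1 / 2 - d) (by linarith) hv).trans ?_
    have h8 : (1 / 8 : ℝ) = Real.exp (-(3 * Real.log 2)) := by
      rw [Real.exp_neg, mul_comm, Real.exp_mul, Real.exp_log two_pos]
      norm_num
    rw [h8, hvr]
    gcongr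
    have : -(1 / 2 - d) ^ 2 / (2 * (1 / (32 * Real.log 2))) =
        -(16 * (1 / 2 - d) ^ 2 * Real.log 2) := by
      field_simp
      ring
    rw [this]
    gcongr
    nlinarith
  have hexpT : Real.exp (-T / 32) ≤ δ / 2 := by
    calc Real.exp (-T / 32) ≤ Real.exp (-Real.log (2 / δ)) := by
          gcongr
          linarith
      _ = δ / 2 := by rw [Real.exp_neg, Real.exp_log (by positivity), inv_div]
  have hregret : 1 / 27 * √(((K : ℝ) - 1) * T * L) ≤ d * T / 8 := by
    have hsplit : √(((K : ℝ) - 1) * T * L) = √(((K : ℝ) - 1) * L / T) * T := by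
      rw [show ((K : ℝ) - 1) * T * L = ((K : ℝ) - 1) * L / T * (T * T) by field_simp,
        Real.sqrt_mul (by positivity), Real.sqrt_mul_self hT0.le]
    -- Source of the constant `27`: `d * T / 8` carries the factor `1 / (32 * √(log 2))`.
    have hs2 : √(Real.log 2) ≤ 27 / 32 := by
      rw [Real.sqrt_le_left (by norm_num)]
      norm_num
      linarith
    have hs20 : 0 < √(Real.log 2) := Real.sqrt_pos.2 hlog20
    rw [hsplit, hd]
    have : (1 / 27 : ℝ) ≤ 1 / (32 * √(Real.log 2)) := by
      gcongr
      linarith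
    calc 1 / 27 * (√(((K : ℝ) - 1) * L / T) * T)
        ≤ 1 / (32 * √(Real.log 2)) * (√(((K : ℝ) - 1) * L / T) * T) := by gcongr
      _ = _ := by ring
  have hdiv : d ^ 2 / (2 * v) * T ≤ ((K : ℝ) - 1) * L := by
    have : d ^ 2 / (2 * v) = ((K : ℝ) - 1) * L / T := by
      rw [← hd2, hvr]
      field_simp
      ring
    rw [this, div_mul_cancel₀ _ hT0.ne']
  -- An equality, as `exp (-L) = 4 * δ`: each of the two environments gets a share `δ`.
  have hexpL : 2 * δ ≤ Real.exp (-L) / 2 := by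
    rw [Real.exp_neg, hL, Real.exp_log (by positivity)]
    field_simp
    norm_num
  obtain ⟨s, b, z, hs, hb, hz⟩ :=
    alg.exists_hard_noise hK hv hδ₀ hd0 hdiv hexpL htail hexpT
  refine ⟨noisyLoss s z, noisyLoss_mem_Icc s z,
    hz.trans (measure_mono fun I hI => hregret.trans hI), ⟨b, fun t j => ?_⟩,
    noisyLoss_sub_le s z hs⟩
  refine noisyLoss_le_noisyLoss s z ?_ t
  by_cases h : j = b
  · rw [h]
  · linarith [hb j h]
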